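/- Let $a>-2$, $B>0$, $\rho>0$ be real numbers and let $I=[\alpha,\beta]\subset\mathbb R$ be a compact interval with $|c|\le B\rho^{-2}$ for all $c\in I$. Consider systems $$\dot x=x^2,\qquad \dot y=-y(1+ax)+g(x,y),\qquad g(x,y)=\sum_{k\ge 2}f_kx^k+\mu\sum_{k\ge 1}\sum_{l\ge 2}h_{k,l}x^ky^l, \tag{1}$$ with real coefficients satisfying $|f_k|\le B\rho^{-k}$, $|h_{k,l}|\le\rho^{-k-l}$, with $f_2\in I$, and with $\mu\ge 0$. A center manifold of $(1)$ is a graph $y=m(x)$ of a $C^1$ function defined near $x=0$ with $m(0)=m'(0)=0$ and $x^2m'(x)=-m(x)(1+ax)+g(x,m(x))$ for all $x$ near $0$. We say that the center manifold is analytic if some such $m$ is real analytic at $x=0$, and nonanalytic if none is. Let $\sum_{k\ge2}m_kx^k$ denote the formal power series solution of this equation, and put $$S_\infty:=\lim_{k\to\infty}\frac{(-1)^k m_k}{\Gamma(k+a)}.$$ Then there is a $\mu_0>0$, depending only on $a,B,\rho,I$, such that the following holds for every system $(1)$ as above with $0\le\mu<\mu_0$. 1. When $f_2$ is replaced by a parameter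 $c$ (all other coefficients and $\mu$ being fixed), the formal series solution exists and is unique and the limit $S_\infty=S_\infty(c)$ exists for all $c$ in some open neighborhood of $I$; the function $S_\infty$ is $C^1$ there and $\frac{\partial S_\infty}{\partial f_2}(c)\ne 0$ for all $c\in I$. If the center manifold of $(1)$ is analytic, then $S_\infty(f_2)=0$. 2. If the center manifold of $(1)$ is analytic, then there is a $q_0>0$ such that for every real $q$ with $0<|q|<q_0$ the center manifold of the perturbed system $$\dot x=x^2,\qquad \dot y=-y(1+ax)+g(x,y)+qx^2$$ is nonanalytic. 3. Hence nonanalyticity is generic: the system obtained from $(1)$ by replacing $f_2$ by $c$ has an analytic center manifold for at most one value $c\in I$. -/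

import Mathlib

open Filter Topology

/-- Conditions on the coefficients of `f(x) = ∑_{k ≥ 2} f k * x ^ k`. -/
def AdmissibleF (B ρ : ℝ) (f : ℕ → ℝ) : Prop :=
  f 0 = 0 ∧ f 1 = 0 ∧ ∀ k, |f k| ≤ B * (ρ ^ k)⁻¹

/-- Conditions on the coefficients of `h(x, y) = ∑_{k ≥ 1} ∑_{l ≥ 2} h k l * x ^ k * y ^ l`. -/
def AdmissibleH (ρ : ℝ) (h : ℕ → ℕ → ℝ) : Prop :=
  (∀ l, h 0 l = 0) ∧ (∀ k, h k 0 = 0) ∧ (∀ k, h k 1 = 0) ∧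
    ∀ k l, |h k l| ≤ (ρ ^ (k + l))⁻¹

/-- The nonlinearity `g(x, y) = f(x) + μ * h(x, y)`. For admissible coefficients both series
converge absolutely for `|x|, |y| < ρ`; only such `x, y` are relevant below. -/
noncomputable def nonlinearity (f : ℕ → ℝ) (h : ℕ → ℕ → ℝ) (μ : ℝ) (x y : ℝ) : ℝ :=
  (∑' k : ℕ, f k * x ^ k) + μ * ∑' p : ℕ × ℕ, h p.1 p.2 * x ^ p.1 * y ^ p.2

/-- The graph `y = m(x)`, for `x` near `0`, is a center manifold of the origin of
`x' = x ^ 2`, `y' = -y * (1 + a * x) + g(x, y)`: it passes through the origin, it is tangent to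
`y = 0` there, and it is invariant. -/
def IsCenterManifold (a : ℝ) (g : ℝ → ℝ → ℝ) (m : ℝ → ℝ) : Prop :=
  ContDiffAt ℝ 1 m 0 ∧ m 0 = 0 ∧ deriv m 0 = 0 ∧
    ∀ᶠ x in 𝓝 (0 : ℝ), x ^ 2 * deriv m x = -(m x) * (1 + a * x) + g x (m x)

/-- The center manifold is analytic. Center manifolds are in general not unique (for `x < 0`), so
this says that some center manifold is analytic at the origin; its negation says that every
center manifold is nonanalytic there. -/
def HasAnalyticCenterManifold (a : ℝ) (g : ℝ → ℝ → ℝ) : Prop :=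
  ∃ m : ℝ → ℝ, IsCenterManifold a g m ∧ AnalyticAt ℝ m 0

/-- The formal composition `∑_{k, l} h k l * X ^ k * m ^ l`. If `m` has zero constant
coefficient, then `m ^ l` does not contribute to the coefficient of `X ^ n` for `l > n`, so that
the sum over `l ≤ n` is complete. -/
noncomputable def formalComp (h : ℕ → ℕ → ℝ) (m : PowerSeries ℝ) : PowerSeries ℝ :=
  PowerSeries.mk fun n => ∑ l ∈ Finset.range (n + 1), ∑ p ∈ Finset.HasAntidiagonal.antidiagonal n,
    h p.1 l * PowerSeries.coeff p.2 (m ^ l)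

/-- `m = ∑_{k ≥ 2} m_k X ^ k` is the formal series expansion of the center manifold: it solves
`x ^ 2 * y' + y * (1 + a * x) = f(x) + μ * h(x, y)` formally. -/
def IsFormalCenterManifold (a : ℝ) (f : ℕ → ℝ) (h : ℕ → ℕ → ℝ) (μ : ℝ)
    (m : PowerSeries ℝ) : Prop :=
  PowerSeries.coeff 0 m = 0 ∧ PowerSeries.coeff 1 m = 0 ∧
    PowerSeries.X ^ 2 * PowerSeries.derivative ℝ m
        + m * (1 + PowerSeries.C a * PowerSeries.X) =
      PowerSeries.mk f + PowerSeries.C μ * formalComp h m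

/-- The number `S_∞ = lim_{k → ∞} (-1) ^ k * m_k / Γ(k + a)`, where `∑ m_k X ^ k` is the
(unique) formal series expansion of the center manifold, is well defined and equal to `s`. -/
def HasSInfty (a : ℝ) (f : ℕ → ℝ) (h : ℕ → ℕ → ℝ) (μ : ℝ) (s : ℝ) : Prop :=
  (∃! m : PowerSeries ℝ, IsFormalCenterManifold a f h μ m) ∧
    ∀ m : PowerSeries ℝ, IsFormalCenterManifold a f h μ m →
      Tendsto (fun k : ℕ => (-1) ^ k * PowerSeries.coeff k m / Real.Gamma (k + a))
        atTop (𝓝 s)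

/-! Comparing coefficients turns the invariance equation into the recursion `m_{k+2} = -(k+1+a)
m_{k+1} + f_{k+2} + μ H_{k+2}(m)`, where `H(m)` is the formal composition. Dividing by `(-1)^j
Γ(j+2+a)` makes it telescope: `(-1)^j m_{j+2} / Γ(j+2+a)` is the `j`-th partial sum of `∑ (-1)^i
(f_{i+2} + μ H_{i+2}) / Γ(i+2+a)`, so `S_∞` is the sum of this series
(`IsRecursiveSolution.coeff_div_gammaWeight`).

Convergence is a bootstrap. If `|m_{j+2}| ≤ M Γ(j+2+a)` up to some order, then `H_{i+2} =
O(Γ(i-1+a))`, because every monomial of `H` has degree at least 5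
(`exists_norm_coeff_ringFormalComp_le`). The quotients by `Γ(i+2+a)` are summable, and small `μ`
reproduces the bound with the same `M` (`IsRecursiveSolution.weightBounded`).

All estimates are uniform in a complex parameter `c` replacing `f_2`, and every coefficient is a
polynomial in `c`. Hence `S_∞(c) = const + c / Γ(2+a) + μ E(c)` with `E` holomorphic and bounded
(`exists_sInfty_decomposition`). Cauchy's estimate makes the derivative positive for small `μ`
(`hasDerivAt_re_pos`). An analytic center manifold has the formal solution as Taylor series, with
coefficients of at most geometric growth, which forces `S_∞ = 0`
(`eq_zero_of_hasAnalyticCenterManifold`). A strictly increasing function has at most one zero. -/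

/-! ### Formal solutions over a commutative ring. -/

section FormalSolution

variable {A A' : Type*} [CommRing A] [CommRing A']

/-- The formal composition `∑ h k l * X ^ k * m ^ l` over a commutative ring. -/
noncomputable def ringFormalComp (h : ℕ → ℕ → A) (m : PowerSeries A) : PowerSeries A :=
  PowerSeries.mk fun n => ∑ l ∈ Finset.range (n + 1), ∑ p ∈ Finset.HasAntidiagonal.antidiagonal n,
    h p.1 l * PowerSeries.coeff p.2 (m ^ l)

/-- Formal center manifolds over a commutative ring, in terms of their coefficients. -/
def IsRecursiveSolution (a : A) (f : ℕ → A) (h : ℕ → ℕ → A) (μ : A) (m : PowerSeries A) : Prop :=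
  PowerSeries.coeff 0 m = 0 ∧ PowerSeries.coeff 1 m = 0 ∧ ∀ k : ℕ,
    PowerSeries.coeff (k + 2) m = -((k + 1 + a) * PowerSeries.coeff (k + 1) m) + f (k + 2)
      + μ * PowerSeries.coeff (k + 2) (ringFormalComp h m)

/-- Since `h 0 l = 0`, each term carries a factor `X`, so degree `k` of the composition sees only
coefficients of `m` below `k`. -/
theorem coeff_ringFormalComp_congr {h : ℕ → ℕ → A} (h0 : ∀ l, h 0 l = 0) {m m' : PowerSeries A}
    {k : ℕ} (hm : PowerSeries.X ^ k ∣ m - m') :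
    PowerSeries.coeff k (ringFormalComp h m) = PowerSeries.coeff k (ringFormalComp h m') := by
  simp only [ringFormalComp, PowerSeries.coeff_mk]
  refine Finset.sum_congr rfl fun l _ => Finset.sum_congr rfl fun p hp => ?_
  rcases Nat.eq_zero_or_pos p.1 with hz | hpos
  · rw [hz, h0, zero_mul, zero_mul]
  · have hlt : p.2 < k := by have := Finset.HasAntidiagonal.mem_antidiagonal.mp hp; omega
    have := PowerSeries.X_pow_dvd_iff.mp (hm.trans (sub_dvd_pow_sub_pow m m' l)) p.2 hlt
    rw [map_sub, sub_eq_zero] at this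
    rw [this]

theorem coeff_ringFormalComp_zero {h : ℕ → ℕ → A} (h0 : ∀ l, h 0 l = 0) (m : PowerSeries A) :
    PowerSeries.coeff 0 (ringFormalComp h m) = 0 := by
  simp [ringFormalComp, h0]

theorem coeff_ringFormalComp_one {h : ℕ → ℕ → A} (h0 : ∀ l, h 0 l = 0) (h1 : ∀ k, h k 0 = 0)
    {m : PowerSeries A} (hm : PowerSeries.coeff 0 m = 0) :
    PowerSeries.coeff 1 (ringFormalComp h m) = 0 := by
  have hm' : PowerSeries.constantCoeff m = 0 := by simpa using hm
  simp [ringFormalComp, h0, h1, Finset.sum_range_succ, hm', Finset.Nat.antidiagonal_succ]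

/-- A contraction argument in the `X`-adic topology: solutions are the fixed points of `Φ`, which
gains one order of agreement at each application. -/
theorem existsUnique_isRecursiveSolution (a : A) (f : ℕ → A) {h : ℕ → ℕ → A}
    (h0 : ∀ l, h 0 l = 0) (μ : A) : ∃! m, IsRecursiveSolution a f h μ m := by
  let Φ : PowerSeries A → PowerSeries A := fun m => PowerSeries.mk fun n =>
    if n < 2 then 0 else -(((n - 1 : ℕ) + a) * PowerSeries.coeff (n - 1) m) + f n
      + μ * PowerSeries.coeff n (ringFormalComp h m)
  have hfix : ∀ m, IsRecursiveSolution a f h μ m ↔ m = Φ m := by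
    intro m
    constructor
    · rintro ⟨m0, m1, hk⟩
      ext n
      match n with
      | 0 => simpa [Φ] using m0
      | 1 => simpa [Φ] using m1
      | k + 2 => rw [hk k]; simp [Φ]
    · intro hm
      refine ⟨?_, ?_, fun k => ?_⟩
      · rw [hm]; simp [Φ]
      · rw [hm]; simp [Φ]
      · conv_lhs => rw [hm]
        simp [Φ]
  have hcontr : ∀ {m m' : PowerSeries A} {k : ℕ}, PowerSeries.X ^ k ∣ m - m' →
      PowerSeries.X ^ (k + 1) ∣ Φ m - Φ m' := by
    intro m m' k hd
    rw [PowerSeries.X_pow_dvd_iff]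
    intro n hn
    simp only [Φ, map_sub, PowerSeries.coeff_mk]
    split_ifs with hlt
    · simp
    · have e1 := PowerSeries.X_pow_dvd_iff.mp hd (n - 1) (by omega)
      rw [map_sub, sub_eq_zero] at e1
      rw [e1, coeff_ringFormalComp_congr h0 ((pow_dvd_pow _ (Nat.lt_succ_iff.mp hn)).trans hd),
        sub_self]
  have hiter : ∀ k, PowerSeries.X ^ k ∣ Φ^[k + 1] 0 - Φ^[k] 0 := by
    intro k
    induction k with
    | zero => simp
    | succ k ih =>
      have := hcontr ih
      rwa [← Function.iterate_succ_apply' Φ, ← Function.iterate_succ_apply' Φ] at this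
  have hstab : ∀ k j, PowerSeries.X ^ k ∣ Φ^[k + j] 0 - Φ^[k] 0 := by
    intro k j
    induction j with
    | zero => simp
    | succ j ih =>
      have := dvd_add ((pow_dvd_pow _ (Nat.le_add_right k j)).trans (hiter (k + j))) ih
      simpa [add_assoc] using this
  -- The coefficient of degree `n` is stationary from the iterate `n + 1` on, so this diagonal
  -- series is the limit.
  let m : PowerSeries A := PowerSeries.mk fun n => PowerSeries.coeff n (Φ^[n + 1] 0)
  have hm : ∀ k, PowerSeries.X ^ k ∣ m - Φ^[k] 0 := by
    intro k
    rw [PowerSeries.X_pow_dvd_iff]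
    intro n hn
    obtain ⟨j, rfl⟩ := Nat.exists_eq_add_of_le hn
    have := PowerSeries.X_pow_dvd_iff.mp (hstab (n + 1) j) n (by omega)
    rw [map_sub, sub_eq_zero] at this
    simp only [map_sub, m, PowerSeries.coeff_mk]
    rw [show n.succ + j = n + 1 + j from rfl, this, sub_self]
  have heq : ∀ m m' : PowerSeries A, (∀ k, PowerSeries.X ^ k ∣ m - m') → m = m' := by
    intro m m' hd
    ext n
    have := PowerSeries.X_pow_dvd_iff.mp (hd (n + 1)) n (by omega)
    rwa [map_sub, sub_eq_zero] at this
  have hmfix : m = Φ m := heq _ _ fun k => by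
    have h1 := hm (k + 1)
    have h2 := hcontr (hm k)
    rw [← Function.iterate_succ_apply' Φ] at h2
    have := dvd_sub h1 h2
    rw [sub_sub_sub_cancel_right] at this
    exact (pow_dvd_pow _ (Nat.le_succ k)).trans this
  refine ⟨m, (hfix m).mpr hmfix, fun m' hm' => heq _ _ fun k => ?_⟩
  induction k with
  | zero => simp
  | succ k ih =>
    have h1 := hcontr ih
    rwa [← (hfix m').mp hm', ← hmfix] at h1

/-- Used for specialising the parameter and for passing from `ℝ` to `ℂ`; uniqueness then identifies
the images. -/
theorem IsRecursiveSolution.map {a : A} {f : ℕ → A} {h : ℕ → ℕ → A} {μ : A} {m : PowerSeries A}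
    (hm : IsRecursiveSolution a f h μ m) (φ : A →+* A') :
    IsRecursiveSolution (φ a) (fun k => φ (f k)) (fun k l => φ (h k l)) (φ μ)
      (PowerSeries.map φ m) := by
  have hc : ringFormalComp (fun k l => φ (h k l)) (PowerSeries.map φ m)
      = PowerSeries.map φ (ringFormalComp h m) := by
    ext n
    simp [ringFormalComp, ← map_pow]
  obtain ⟨m0, m1, hk⟩ := hm
  refine ⟨by simp [m0] , by simp [m1], fun k => ?_⟩
  rw [hc]
  simp [hk k]

end FormalSolution

theorem isFormalCenterManifold_iff {a μ : ℝ} {f : ℕ → ℝ} {h : ℕ → ℕ → ℝ}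
    (f0 : f 0 = 0) (f1 : f 1 = 0) (h0 : ∀ l, h 0 l = 0) (h1 : ∀ k, h k 0 = 0)
    (m : PowerSeries ℝ) :
    IsFormalCenterManifold a f h μ m ↔ IsRecursiveSolution a f h μ m := by
  refine and_congr_right fun m0 => and_congr_right fun m1 => ?_
  have hc : formalComp h m = ringFormalComp h m := rfl
  have hl : ∀ k, PowerSeries.coeff (k + 2) (PowerSeries.X ^ 2 * PowerSeries.derivative ℝ m
        + m * (1 + PowerSeries.C a * PowerSeries.X)) =
      (k + 1 + a) * PowerSeries.coeff (k + 1) m + PowerSeries.coeff (k + 2) m := by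
    intro k
    rw [map_add, PowerSeries.coeff_X_pow_mul, mul_add, mul_one, map_add, mul_left_comm,
      PowerSeries.coeff_C_mul, show k + 2 = (k + 1) + 1 from rfl, PowerSeries.coeff_succ_mul_X,
      PowerSeries.coeff_derivative]
    ring
  rw [PowerSeries.ext_iff, hc]
  constructor
  · intro H k
    have := H (k + 2)
    rw [hl, map_add, PowerSeries.coeff_mk, PowerSeries.coeff_C_mul] at this
    linarith
  · intro H n
    match n with
    | 0 =>
      rw [map_add (PowerSeries.coeff 0) (PowerSeries.mk f), PowerSeries.coeff_C_mul,
        coeff_ringFormalComp_zero h0]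
      simpa [f0] using m0
    | 1 =>
      rw [map_add (PowerSeries.coeff 1) (PowerSeries.mk f), PowerSeries.coeff_C_mul,
        coeff_ringFormalComp_one h0 h1 m0]
      rw [PowerSeries.coeff_mk, f1, mul_add, mul_one, mul_left_comm, map_add, map_add, m1,
        PowerSeries.coeff_C_mul, show (1 : ℕ) = 0 + 1 from rfl, PowerSeries.coeff_succ_mul_X, m0,
        PowerSeries.coeff_X_pow_mul']
      simp
    | k + 2 =>
      rw [hl, H k, map_add, PowerSeries.coeff_mk, PowerSeries.coeff_C_mul]
      ring

/-! ### Gamma weights and their convolution estimates. -/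

section Weights

/-- The weight `Γ(j + 2 + a)` of the coefficient of `X ^ (j + 2)`. -/
noncomputable def gammaWeight (a : ℝ) (j : ℕ) : ℝ := Real.Gamma (j + 2 + a)

variable {a : ℝ}

theorem gammaWeight_pos (ha : -2 < a) (j : ℕ) : 0 < gammaWeight a j :=
  Real.Gamma_pos_of_pos (by have : (0 : ℝ) ≤ j := j.cast_nonneg; linarith)

theorem gammaWeight_succ (ha : -2 < a) (j : ℕ) :
    gammaWeight a (j + 1) = (j + 2 + a) * gammaWeight a j := by
  have : (0 : ℝ) ≤ j := j.cast_nonneg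
  rw [gammaWeight, gammaWeight, ← Real.Gamma_add_one (by linarith)]
  congr 1
  push_cast
  ring

/-- Log-convexity: the ratio of consecutive weights at `j` is `j + 2 + a`, which increases with `j`.
-/
theorem gammaWeight_mul_le (ha : -2 < a) (r p q : ℕ) :
    gammaWeight a (r + p) * gammaWeight a (r + q) ≤ gammaWeight a r * gammaWeight a (r + p + q) := by
  induction p with
  | zero => simp
  | succ p ih =>
    have e1 : gammaWeight a (r + (p + 1)) = ((r + p : ℕ) + 2 + a) * gammaWeight a (r + p) :=
      gammaWeight_succ ha (r + p)
    have e2 : gammaWeight a (r + (p + 1) + q)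
        = ((r + p + q : ℕ) + 2 + a) * gammaWeight a (r + p + q) := by
      rw [show r + (p + 1) + q = (r + p + q) + 1 by ring, gammaWeight_succ ha]
    rw [e1, e2]
    have hc : (((r + p : ℕ) : ℝ) + 2 + a) ≤ ((r + p + q : ℕ) : ℝ) + 2 + a := by
      push_cast; linarith [(q.cast_nonneg : (0 : ℝ) ≤ q)]
    have hn : 0 ≤ ((r + p : ℕ) : ℝ) + 2 + a := by
      have : (0 : ℝ) ≤ ((r + p : ℕ) : ℝ) := Nat.cast_nonneg _
      linarith
    calc _ = (((r + p : ℕ) : ℝ) + 2 + a) * (gammaWeight a (r + p) * gammaWeight a (r + q)) := by ring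
      _ ≤ (((r + p + q : ℕ) : ℝ) + 2 + a) * (gammaWeight a r * gammaWeight a (r + p + q)) :=
        mul_le_mul hc ih (mul_pos (gammaWeight_pos ha _) (gammaWeight_pos ha _)).le (hn.trans hc)
      _ = _ := by ring

/-- The constant in the convolution estimate for the weights. -/
noncomputable def convConst (a : ℝ) : ℝ := 2 * gammaWeight a 0 + gammaWeight a 1

theorem convConst_pos (ha : -2 < a) : 0 < convConst a :=
  add_pos (mul_pos two_pos (gammaWeight_pos ha 0)) (gammaWeight_pos ha 1)

/-- The two end terms give `2 * gammaWeight a 0`. By log-convexity each interior term is at most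
that with an index 1, and their number is absorbed by the last ratio of weights. -/
theorem sum_gammaWeight_mul_le (ha : -2 < a) (n : ℕ) :
    ∑ p ∈ Finset.HasAntidiagonal.antidiagonal n, gammaWeight a p.1 * gammaWeight a p.2
      ≤ convConst a * gammaWeight a n := by
  have v0 := gammaWeight_pos ha 0
  have v1 := gammaWeight_pos ha 1
  match n with
  | 0 =>
    simp only [Finset.HasAntidiagonal.antidiagonal_zero, Finset.sum_singleton, convConst]
    nlinarith
  | 1 =>
    simp only [Finset.Nat.antidiagonal_succ, Finset.HasAntidiagonal.antidiagonal_zero, convConst]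
    simp
    nlinarith
  | n + 2 =>
    rw [Finset.Nat.sum_antidiagonal_succ, Finset.Nat.sum_antidiagonal_succ']
    have hmid : ∀ p ∈ Finset.HasAntidiagonal.antidiagonal n,
        gammaWeight a (p.1 + 1) * gammaWeight a (p.2 + 1)
          ≤ gammaWeight a 1 * gammaWeight a (n + 1) := by
      intro p hp
      have hpn := Finset.HasAntidiagonal.mem_antidiagonal.mp hp
      have := gammaWeight_mul_le ha 1 p.1 p.2
      rwa [show 1 + p.1 + p.2 = n + 1 by omega, add_comm 1, add_comm 1] at this
    have hs := Finset.sum_le_card_nsmul _ _ _ hmid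
    rw [Finset.Nat.card_antidiagonal, nsmul_eq_mul] at hs
    have e : gammaWeight a (n + 2) = ((n + 1 : ℕ) + 2 + a) * gammaWeight a (n + 1) :=
      gammaWeight_succ ha (n + 1)
    have v2 := gammaWeight_pos ha (n + 1)
    have : ((n + 1 : ℕ) : ℝ) * (gammaWeight a 1 * gammaWeight a (n + 1))
        ≤ gammaWeight a 1 * gammaWeight a (n + 2) := by
      rw [e]
      nlinarith [mul_pos v1 v2]
    simp only [convConst]
    linarith

theorem summable_pow_div_gammaWeight (ha : -2 < a) (R : ℝ) (hR : 0 < R) :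
    Summable (fun j : ℕ => R ^ j / gammaWeight a j) := by
  refine summable_of_ratio_test_tendsto_lt_one (l := 0) one_pos ?_ ?_
  · exact Eventually.of_forall fun j => (div_pos (pow_pos hR j) (gammaWeight_pos ha j)).ne'
  · have hlim : Tendsto (fun j : ℕ => R / ((j : ℝ) + (2 + a))) atTop (𝓝 0) :=
      Tendsto.const_div_atTop (tendsto_atTop_add_const_right _ _ tendsto_natCast_atTop_atTop) _
    refine hlim.congr fun j => ?_
    have hp := gammaWeight_pos ha j
    have hj : (0 : ℝ) < j + 2 + a := by linarith [(j.cast_nonneg : (0 : ℝ) ≤ j)]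
    rw [Real.norm_of_nonneg (div_pos (pow_pos hR _) (gammaWeight_pos ha _)).le,
      Real.norm_of_nonneg (div_pos (pow_pos hR _) (gammaWeight_pos ha _)).le, gammaWeight_succ ha,
      ← add_assoc]
    field_simp
    ring

theorem exists_pow_le_gammaWeight (ha : -2 < a) (R : ℝ) (hR : 0 < R) :
    ∃ K, 0 < K ∧ ∀ j : ℕ, R ^ j ≤ K * gammaWeight a j := by
  have hs := summable_pow_div_gammaWeight ha R hR
  refine ⟨∑' j : ℕ, R ^ j / gammaWeight a j, hs.tsum_pos
    (fun j => (div_pos (pow_pos hR j) (gammaWeight_pos ha j)).le) 0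
    (div_pos (pow_pos hR _) (gammaWeight_pos ha _)), fun j => ?_⟩
  rw [← div_le_iff₀ (gammaWeight_pos ha j)]
  exact hs.le_tsum j fun i _ => (div_pos (pow_pos hR i) (gammaWeight_pos ha i)).le

/-- The quotient decays like `j ^ (-3)`. The shift 3 is the gap between degree 5, where the
composition starts, and degree 2, where `m` starts. -/
theorem summable_gammaWeight_div (ha : -2 < a) :
    Summable (fun j : ℕ => gammaWeight a j / gammaWeight a (j + 3)) := by
  -- Dropping the first term makes the three factors at least `1`, `j + 1`, `j + 1`, even for `a`
  -- close to `-2`.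
  rw [← summable_nat_add_iff 1]
  refine Summable.of_nonneg_of_le
    (fun j => (div_pos (gammaWeight_pos ha _) (gammaWeight_pos ha _)).le) (fun j => ?_)
    ((summable_nat_add_iff 1).mpr (Real.summable_one_div_nat_pow.mpr one_lt_two))
  have hj : (0 : ℝ) ≤ j := j.cast_nonneg
  have hp := gammaWeight_pos ha (j + 1)
  have e : gammaWeight a (j + 1 + 3) = (((j + 3 : ℕ) + 2 + a) * (((j + 2 : ℕ) + 2 + a) *
      ((j + 1 : ℕ) + 2 + a))) * gammaWeight a (j + 1) := by
    rw [show j + 1 + 3 = j + 3 + 1 by ring, gammaWeight_succ ha (j + 3), gammaWeight_succ ha (j + 2),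
      gammaWeight_succ ha (j + 1)]
    ring
  have hle : ((j + 1 : ℕ) : ℝ) ^ 2 ≤ ((j + 3 : ℕ) + 2 + a) * (((j + 2 : ℕ) + 2 + a) *
      ((j + 1 : ℕ) + 2 + a)) := by
    push_cast
    calc ((j : ℝ) + 1) ^ 2 = 1 * ((j + 1) * (j + 1)) := by ring
      _ ≤ _ := mul_le_mul (by linarith) (mul_le_mul (by linarith) (by linarith) (by linarith)
          (by linarith)) (by positivity) (by linarith)
  have hq : (0 : ℝ) < ((j + 1 : ℕ) : ℝ) ^ 2 := by positivity
  rw [e, div_le_div_iff₀ (mul_pos (hq.trans_le hle) hp) hq, one_mul, mul_comm]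
  exact mul_le_mul_of_nonneg_right hle hp.le

end Weights

/-! ### Weighted bounds for products and for the formal composition. -/

section WeightBounds

/-- The first `N` coefficients of `p` are bounded by `M` times the weights. -/
def WeightBounded (a : ℝ) (N : ℕ) (M : ℝ) (p : PowerSeries ℂ) : Prop :=
  ∀ j < N, ‖PowerSeries.coeff j p‖ ≤ M * gammaWeight a j

variable {a : ℝ}

theorem WeightBounded.mul (ha : -2 < a) {N : ℕ} {M M' : ℝ} {p q : PowerSeries ℂ} (hM : 0 ≤ M)
    (hM' : 0 ≤ M') (hp : WeightBounded a N M p) (hq : WeightBounded a N M' q) :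
    WeightBounded a N (M * (convConst a * M')) (p * q) := by
  intro j hj
  rw [PowerSeries.coeff_mul]
  calc _ ≤ ∑ x ∈ Finset.HasAntidiagonal.antidiagonal j,
        M * M' * (gammaWeight a x.1 * gammaWeight a x.2) := by
        refine norm_sum_le_of_le _ fun x hx => ?_
        have hx' := Finset.HasAntidiagonal.mem_antidiagonal.mp hx
        rw [norm_mul]
        calc _ ≤ (M * gammaWeight a x.1) * (M' * gammaWeight a x.2) :=
              mul_le_mul (hp _ (by omega)) (hq _ (by omega)) (norm_nonneg _)
                (mul_nonneg hM (gammaWeight_pos ha _).le)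
          _ = _ := by ring
    _ ≤ M * M' * (convConst a * gammaWeight a j) := by
        rw [← Finset.mul_sum]
        exact mul_le_mul_of_nonneg_left (sum_gammaWeight_mul_le ha j) (mul_nonneg hM hM')
    _ = _ := by ring

theorem WeightBounded.pow_succ (ha : -2 < a) {N : ℕ} {M : ℝ} {p : PowerSeries ℂ} (hM : 0 ≤ M)
    (hp : WeightBounded a N M p) (l : ℕ) :
    WeightBounded a N (M * (convConst a * M) ^ l) (p ^ (l + 1)) := by
  induction l with
  | zero => simpa using hp
  | succ l ih =>
    have h := ih.mul ha (mul_nonneg hM (pow_nonneg (mul_nonneg (convConst_pos ha).le hM) l)) hM hp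
    rwa [mul_assoc, ← _root_.pow_succ, ← _root_.pow_succ] at h

theorem gammaWeight_mul_le_convConst (ha : -2 < a) (i j : ℕ) :
    gammaWeight a i * gammaWeight a j ≤ convConst a * gammaWeight a (i + j) :=
  (Finset.single_le_sum (f := fun p : ℕ × ℕ => gammaWeight a p.1 * gammaWeight a p.2)
    (fun p _ => (mul_pos (gammaWeight_pos ha p.1) (gammaWeight_pos ha p.2)).le)
    (Finset.HasAntidiagonal.mem_antidiagonal.mpr (rfl : (i, j).1 + (i, j).2 = i + j))).trans
    (sum_gammaWeight_mul_le ha (i + j))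

theorem coeff_X_sq_mul_pow {A : Type*} [CommRing A] (n : PowerSeries A) (j l : ℕ) :
    PowerSeries.coeff j ((PowerSeries.X ^ 2 * n) ^ l)
      = if 2 * l ≤ j then PowerSeries.coeff (j - 2 * l) (n ^ l) else 0 := by
  rw [mul_pow, ← pow_mul, PowerSeries.coeff_X_pow_mul']

/-- All terms of the formal composition with `X ^ 2 * n` have degree at least `5`. -/
theorem coeff_ringFormalComp_of_lt_five {A : Type*} [CommRing A] {h : ℕ → ℕ → A}
    (h0 : ∀ l, h 0 l = 0) (h1 : ∀ k, h k 0 = 0) (h2 : ∀ k, h k 1 = 0) (n : PowerSeries A)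
    {k : ℕ} (hk : k < 5) :
    PowerSeries.coeff k (ringFormalComp h (PowerSeries.X ^ 2 * n)) = 0 := by
  rw [ringFormalComp, PowerSeries.coeff_mk]
  refine Finset.sum_eq_zero fun l _ => Finset.sum_eq_zero fun p hp => ?_
  have hp' := Finset.HasAntidiagonal.mem_antidiagonal.mp hp
  match l, p with
  | 0, _ => rw [h1, zero_mul]
  | 1, _ => rw [h2, zero_mul]
  | l + 2, (0, _) => rw [h0, zero_mul]
  | l + 2, (i + 1, j) =>
    have : i + 1 + j = k := hp'
    rw [coeff_X_sq_mul_pow, if_neg (by omega), mul_zero]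

/-- In a term `X ^ (i + 1) * (X ^ 2 * n) ^ (l + 2)` the degree left to `n ^ (l + 2)` is `t = k - (i
+ 2 * l)`. The factors exponential in `i` and `l` are dominated by the weight at `i + 2 * l`, and
the product of the weights at `i + 2 * l` and `t` by the weight at `k`. The constant is uniform in
`h`, `N` and `n`. -/
theorem exists_norm_coeff_ringFormalComp_le (ha : -2 < a) {ρ : ℝ} (hρ : 0 < ρ) {M : ℝ}
    (hM : 0 ≤ M) : ∃ K, 0 < K ∧ ∀ h : ℕ → ℕ → ℂ, (∀ l, h 0 l = 0) → (∀ k, h k 0 = 0) →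
      (∀ k, h k 1 = 0) → (∀ k l, ‖h k l‖ ≤ (ρ ^ (k + l))⁻¹) → ∀ (N : ℕ) (n : PowerSeries ℂ),
      WeightBounded a N M n → ∀ k < N,
        ‖PowerSeries.coeff (k + 5) (ringFormalComp h (PowerSeries.X ^ 2 * n))‖
          ≤ K * gammaWeight a k := by
  have hC := convConst_pos ha
  set D := convConst a * M with hD
  have hD0 : 0 ≤ D := mul_nonneg hC.le hM
  set R := 1 + ρ⁻¹ + D with hR
  have hρi : 0 < ρ⁻¹ := inv_pos.mpr hρ
  have hR1 : 1 ≤ R := by linarith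
  -- The base is `2 * R` rather than `R`: the spare powers of 2 become geometric factors that make
  -- the sums over both indices converge.
  obtain ⟨K, hK, hpow⟩ := exists_pow_le_gammaWeight ha (2 * R) (by linarith)
  set Q := M * (2 * R) ^ 5 * K * convConst a with hQ
  have hQ0 : 0 ≤ Q := by positivity
  -- Each factor 2 is a geometric series; the summand 1 keeps the constant positive when `M = 0`.
  refine ⟨Q * 2 * 2 + 1, by positivity, fun h h0 h1 h2 hh N n hn k hk => ?_⟩
  have hv := gammaWeight_pos ha k
  have hterm : ∀ (l : ℕ) (p : ℕ × ℕ), p.1 + p.2 = k + 5 →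
      ‖h p.1 l * PowerSeries.coeff p.2 ((PowerSeries.X ^ 2 * n) ^ l)‖
        ≤ Q * gammaWeight a k * ((1 / 2) ^ p.1 * (1 / 2) ^ l) := by
    intro l p hp
    have hnn : 0 ≤ Q * gammaWeight a k * ((1 / 2 : ℝ) ^ p.1 * (1 / 2) ^ l) := by positivity
    match l, p with
    | 0, _ => simpa [h1] using hnn
    | 1, _ => simpa [h2] using hnn
    | l + 2, (0, _) => simpa [h0] using hnn
    | l + 2, (i + 1, j) =>
      have hp : i + 1 + j = k + 5 := hp
      rw [coeff_X_sq_mul_pow]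
      split_ifs with hj
      swap
      · simpa using hnn
      dsimp only
      obtain ⟨t, rfl⟩ := Nat.exists_eq_add_of_le hj
      have hk' : k = (i + 2 * l) + t := by omega
      rw [Nat.add_sub_cancel_left, norm_mul]
      have hb := hn.pow_succ ha hM (l + 1) t (by omega)
      have e1 : (ρ ^ (i + 1 + (l + 2)))⁻¹ ≤ R ^ (i + 1 + (l + 2)) := by
        rw [← inv_pow]
        exact pow_le_pow_left₀ hρi.le (by linarith) _
      have e2 : D ^ (l + 1) ≤ R ^ (l + 2) :=
        (pow_le_pow_left₀ hD0 (by linarith) _).trans (pow_le_pow_right₀ hR1 (by omega))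
      have e3 : R ^ (i + 1 + (l + 2)) * R ^ (l + 2)
          = (2 * R) ^ 5 * (2 * R) ^ (i + 2 * l) * ((1 / 2) ^ (i + 1) * (1 / 2) ^ (2 * (l + 2))) := by
        rw [← pow_add, ← pow_add, ← pow_add, show 5 + (i + 2 * l) = i + 1 + 2 * (l + 2) by ring,
          ← mul_pow, show i + 1 + (l + 2) + (l + 2) = i + 1 + 2 * (l + 2) by ring]
        congr 1
        ring
      have e4 : (1 / 2 : ℝ) ^ (2 * (l + 2)) ≤ (1 / 2) ^ (l + 2) :=
        pow_le_pow_of_le_one (by norm_num) (by norm_num) (by omega)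
      have ht := gammaWeight_pos ha t
      have hs := gammaWeight_pos ha (i + 2 * l)
      calc _ ≤ R ^ (i + 1 + (l + 2)) * (M * R ^ (l + 2) * gammaWeight a t) := by
            refine mul_le_mul ((hh _ _).trans e1) (hb.trans ?_) (norm_nonneg _) (by positivity)
            gcongr
        _ = M * (2 * R) ^ 5 * (2 * R) ^ (i + 2 * l) * gammaWeight a t *
              ((1 / 2) ^ (i + 1) * (1 / 2) ^ (2 * (l + 2))) := by
            linear_combination M * gammaWeight a t * e3
        _ ≤ M * (2 * R) ^ 5 * (K * gammaWeight a (i + 2 * l)) * gammaWeight a t *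
              ((1 / 2) ^ (i + 1) * (1 / 2) ^ (l + 2)) := by
            gcongr
            exact hpow _
        _ = M * (2 * R) ^ 5 * K * (gammaWeight a (i + 2 * l) * gammaWeight a t) *
              ((1 / 2) ^ (i + 1) * (1 / 2) ^ (l + 2)) := by ring
        _ ≤ M * (2 * R) ^ 5 * K * (convConst a * gammaWeight a k) *
              ((1 / 2) ^ (i + 1) * (1 / 2) ^ (l + 2)) := by
            have e5 := gammaWeight_mul_le_convConst ha (i + 2 * l) t
            rw [← hk'] at e5
            exact mul_le_mul_of_nonneg_right (mul_le_mul_of_nonneg_left e5 (by positivity))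
              (by positivity)
        _ = _ := by rw [hQ]; ring
  have hgeo : ∀ m : ℕ, ∑ i ∈ Finset.range m, (1 / 2 : ℝ) ^ i ≤ 2 := fun m =>
    (summable_geometric_two.sum_le_tsum _ fun i _ => by positivity).trans_eq tsum_geometric_two
  rw [ringFormalComp, PowerSeries.coeff_mk]
  calc _ ≤ ∑ l ∈ Finset.range (k + 5 + 1), ∑ p ∈ Finset.HasAntidiagonal.antidiagonal (k + 5),
          Q * gammaWeight a k * ((1 / 2) ^ p.1 * (1 / 2) ^ l) :=
        norm_sum_le_of_le _ fun l _ => norm_sum_le_of_le _ fun p hp =>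
          hterm l p (Finset.HasAntidiagonal.mem_antidiagonal.mp hp)
    _ = Q * gammaWeight a k * ((∑ l ∈ Finset.range (k + 5 + 1), (1 / 2) ^ l) *
          ∑ i ∈ Finset.range (k + 5 + 1), (1 / 2) ^ i) := by
        simp_rw [← Finset.mul_sum, ← Finset.sum_mul]
        rw [Finset.Nat.sum_antidiagonal_eq_sum_range_succ_mk, mul_comm (∑ l ∈ _, _)]
        simp [Finset.mul_sum, Finset.sum_mul]
    _ ≤ Q * gammaWeight a k * (2 * 2) := by
        gcongr
        · exact hgeo _
        · exact hgeo _
    _ ≤ _ := by linarith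

end WeightBounds

/-! ### Polynomial dependence on the parameter. -/

section ParametricSolution

open Polynomial in
/-- The formal center manifold with the coefficient `f 2` replaced by an indeterminate. -/
theorem exists_parametricSolution (a μ : ℝ) (f : ℕ → ℝ) {h : ℕ → ℕ → ℝ} (h0 : ∀ l, h 0 l = 0) :
    ∃ m : PowerSeries ℝ[X], IsRecursiveSolution (C a) (Function.update (fun k => C (f k)) 2 X)
      (fun k l => C (h k l)) (C μ) m :=
  (existsUnique_isRecursiveSolution _ _ (fun l => by simp [h0 l]) _).exists

variable {a μ : ℝ} {f : ℕ → ℝ} {h : ℕ → ℕ → ℝ}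

open Polynomial in
theorem IsRecursiveSolution.map_eval₂ {A : Type*} [CommRing A] (φ : ℝ →+* A)
    {m : PowerSeries ℝ[X]}
    (hm : IsRecursiveSolution (C a) (Function.update (fun k => C (f k)) 2 X)
      (fun k l => C (h k l)) (C μ) m) (c : A) :
    IsRecursiveSolution (φ a) (Function.update (fun k => φ (f k)) 2 c) (fun k l => φ (h k l)) (φ μ)
      (PowerSeries.map (eval₂RingHom φ c) m) := by
  have := hm.map (eval₂RingHom φ c)
  simp only [coe_eval₂RingHom, eval₂_C] at this
  convert this using 2 with k
  by_cases hk : k = 2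
  · subst hk; simp
  · simp [hk]

open Polynomial in
-- Each coefficient is the evaluation at `c` of one fixed polynomial, namely the same coefficient
-- computed over `ℝ[X]`.
theorem differentiable_coeff_ringFormalComp_map (m : PowerSeries ℝ[X]) (h : ℕ → ℕ → ℝ) (k : ℕ) :
    Differentiable ℂ fun c : ℂ => PowerSeries.coeff k (ringFormalComp
      (fun k l => (h k l : ℂ)) (PowerSeries.map (eval₂RingHom Complex.ofRealHom c) m)) := by
  have : ∀ c : ℂ, PowerSeries.coeff k (ringFormalComp
      (fun k l => (h k l : ℂ)) (PowerSeries.map (eval₂RingHom Complex.ofRealHom c) m))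
      = ((PowerSeries.coeff k (ringFormalComp (fun k l => C (h k l)) m)).map
          Complex.ofRealHom).eval c := by
    intro c
    rw [eval_map, ← coe_eval₂RingHom]
    simp [ringFormalComp, ← map_pow]
  simp_rw [this]
  exact Polynomial.differentiable _

end ParametricSolution

/-! ### Telescoping, a priori bound, and holomorphy of the limit in the parameter. -/

section SInfty

variable {a : ℝ}

/-- The coefficients of a formal center manifold, divided by their weights, are partial sums. -/
theorem IsRecursiveSolution.coeff_div_gammaWeight (ha : -2 < a) {f : ℕ → ℂ} {h : ℕ → ℕ → ℂ}
    {μ : ℂ} {m : PowerSeries ℂ} (hm : IsRecursiveSolution (a : ℂ) f h μ m) (j : ℕ) :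
    (-1) ^ j * PowerSeries.coeff (j + 2) m / gammaWeight a j
      = ∑ i ∈ Finset.range (j + 1), ((-1) ^ i * f (i + 2) / gammaWeight a i
          + μ * ((-1) ^ i * PowerSeries.coeff (i + 2) (ringFormalComp h m) / gammaWeight a i)) := by
  obtain ⟨-, m1, hk⟩ := hm
  induction j with
  | zero =>
    have := hk 0
    rw [zero_add] at this ⊢
    rw [this, m1]
    simp
    ring
  | succ j ih =>
    rw [Finset.sum_range_succ, ← ih, hk (j + 1)]
    have hv : (gammaWeight a j : ℂ) ≠ 0 := by exact_mod_cast (gammaWeight_pos ha j).ne'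
    have hj : ((j : ℂ) + 2 + a) ≠ 0 := by
      have : (0 : ℝ) < j + 2 + a := by linarith [(j.cast_nonneg : (0 : ℝ) ≤ j)]
      exact_mod_cast this.ne'
    rw [gammaWeight_succ ha]
    push_cast
    field_simp
    ring

/-- The terms of the majorant of `∑ H i / Γ(i + 2 + a)`. -/
noncomputable def compMajorant (a K : ℝ) (i : ℕ) : ℝ :=
  if i < 3 then 0 else K * (gammaWeight a (i - 3) / gammaWeight a i)

theorem compMajorant_nonneg (ha : -2 < a) {K : ℝ} (hK : 0 ≤ K) (i : ℕ) :
    0 ≤ compMajorant a K i := by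
  rw [compMajorant]
  split_ifs
  · exact le_rfl
  · exact mul_nonneg hK (div_pos (gammaWeight_pos ha _) (gammaWeight_pos ha _)).le

theorem summable_compMajorant (ha : -2 < a) (K : ℝ) : Summable (compMajorant a K) := by
  rw [← summable_nat_add_iff 3]
  refine ((summable_gammaWeight_div ha).mul_left K).congr fun i => ?_
  simp [compMajorant]

/-- A uniform a priori bound on the formal center manifold propagates to all orders. -/
theorem IsRecursiveSolution.weightBounded (ha : -2 < a) {K F M : ℝ} {μ : ℝ} (hμ0 : 0 ≤ μ)
    (hK : 0 ≤ K) {f : ℕ → ℂ} {h : ℕ → ℕ → ℂ} {n : PowerSeries ℂ}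
    (hn : IsRecursiveSolution (a : ℂ) f h μ (PowerSeries.X ^ 2 * n))
    (hf : ∀ j, ∑ i ∈ Finset.range (j + 1), ‖f (i + 2)‖ / gammaWeight a i ≤ F)
    (hM : F + μ * ∑' i, compMajorant a K i ≤ M)
    (hcomp : ∀ N, WeightBounded a N M n → ∀ i ≤ N,
      ‖(-1) ^ i * PowerSeries.coeff (i + 2) (ringFormalComp h (PowerSeries.X ^ 2 * n))
        / (gammaWeight a i : ℂ)‖ ≤ compMajorant a K i) (N : ℕ) :
    WeightBounded a N M n := by
  induction N with
  | zero => exact fun j hj => absurd hj (Nat.not_lt_zero j)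
  | succ N ih =>
    intro j hj
    rcases Nat.lt_succ_iff_lt_or_eq.mp hj with hlt | rfl
    · exact ih j hlt
    have hv := gammaWeight_pos ha j
    have hsum := hn.coeff_div_gammaWeight ha j
    rw [PowerSeries.coeff_X_pow_mul] at hsum
    have hnorm : ‖(-1) ^ j * PowerSeries.coeff j n / (gammaWeight a j : ℂ)‖
        = ‖PowerSeries.coeff j n‖ / gammaWeight a j := by
      rw [norm_div, norm_mul, norm_pow, norm_neg, norm_one, one_pow, one_mul,
        Complex.norm_of_nonneg hv.le]
    rw [← div_le_iff₀ hv, ← hnorm, hsum]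
    have hs := (summable_compMajorant ha K).sum_le_tsum (Finset.range (j + 1))
      fun i _ => compMajorant_nonneg ha hK i
    -- Only indices `i ≤ j` occur, and the bound on the coefficients below `j` controls their
    -- composition terms; the induction closes because `F + μ * ∑' i, compMajorant a K i ≤ M`.
    calc _ ≤ ∑ i ∈ Finset.range (j + 1),
          (‖f (i + 2)‖ / gammaWeight a i + μ * compMajorant a K i) := by
          refine norm_sum_le_of_le _ fun i hi => (norm_add_le _ _).trans (add_le_add ?_ ?_)
          · rw [norm_div, norm_mul, norm_pow, norm_neg, norm_one, one_pow, one_mul,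
              Complex.norm_of_nonneg (gammaWeight_pos ha i).le]
          · rw [norm_mul, Complex.norm_of_nonneg hμ0]
            exact mul_le_mul_of_nonneg_left
              (hcomp j ih i (Nat.lt_succ_iff.mp (Finset.mem_range.mp hi))) hμ0
      _ ≤ F + μ * ∑' i, compMajorant a K i := by
          rw [Finset.sum_add_distrib, ← Finset.mul_sum]
          exact add_le_add (hf j) (mul_le_mul_of_nonneg_left hs hμ0)
      _ ≤ M := hM

theorem eq_X_sq_mul {A : Type*} [CommRing A] {m : PowerSeries A}
    (m0 : PowerSeries.coeff 0 m = 0) (m1 : PowerSeries.coeff 1 m = 0) :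
    ∃ n, m = PowerSeries.X ^ 2 * n := by
  refine PowerSeries.X_pow_dvd_iff.mpr fun k hk => ?_
  match k, hk with
  | 0, _ => exact m0
  | 1, _ => exact m1

/-- The parameter is complex so that the bound on `E` will also bound its derivative. Neither `μ₀`
nor `T` depends on the system. -/
theorem exists_sInfty_decomposition (ha : -2 < a) {B ρ R : ℝ} (hB : 0 < B) (hρ : 0 < ρ)
    (hR : 0 < R) :
    ∃ μ₀ T : ℝ, 0 < μ₀ ∧ 0 ≤ T ∧ ∀ (μ : ℝ) (f : ℕ → ℝ) (h : ℕ → ℕ → ℝ), 0 ≤ μ → μ < μ₀ →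
      AdmissibleF B ρ f → AdmissibleH ρ h → ∃ (s₀ : ℂ) (E : ℂ → ℂ),
        DifferentiableOn ℂ E (Metric.ball 0 R) ∧ (∀ c ∈ Metric.ball (0 : ℂ) R, ‖E c‖ ≤ T) ∧
        ∀ c : ℝ, |c| < R → HasSInfty a (Function.update f 2 c) h μ
          (s₀ + c / gammaWeight a 0 + μ * E c).re := by
  have hv0 := gammaWeight_pos ha 0
  have hfs : Summable fun i : ℕ => B * (ρ ^ (i + 2))⁻¹ / gammaWeight a i := by
    refine ((summable_pow_div_gammaWeight ha ρ⁻¹ (inv_pos.mpr hρ)).mul_left (B * (ρ ^ 2)⁻¹)).congr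
      fun i => ?_
    rw [pow_add, mul_inv, inv_pow]
    ring
  have hfn : ∀ i : ℕ, 0 ≤ B * (ρ ^ (i + 2))⁻¹ / gammaWeight a i := fun i =>
    div_nonneg (by positivity) (gammaWeight_pos ha i).le
  -- `F` bounds the weighted sum of the `|f_k|` once `f_2` is replaced by any `c` with `|c| < R`.
  set F := R / gammaWeight a 0 + ∑' i : ℕ, B * (ρ ^ (i + 2))⁻¹ / gammaWeight a i with hF
  have hF0 : 0 ≤ F := add_nonneg (by positivity) (tsum_nonneg hfn)
  obtain ⟨K, hK, hKb⟩ := exists_norm_coeff_ringFormalComp_le ha hρ (M := F + 1) (by linarith)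
  set T := ∑' i, compMajorant a K i with hT
  have hT0 : 0 ≤ T := tsum_nonneg (compMajorant_nonneg ha hK.le)
  -- This choice gives `μ * T ≤ 1`, so the a priori bound closes with `M = F + 1`.
  refine ⟨(T + 1)⁻¹, T, by positivity, hT0, fun μ f h hμ0 hμ hf hh => ?_⟩
  obtain ⟨f0, f1, hfb⟩ := hf
  obtain ⟨h0, h1, h2, hhb⟩ := hh
  have hμT : μ * T ≤ 1 := by
    have := mul_le_mul_of_nonneg_right hμ.le (by linarith : 0 ≤ T + 1)
    rw [inv_mul_cancel₀ (by linarith)] at this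
    nlinarith
  obtain ⟨P, hP⟩ := exists_parametricSolution a μ f h0
  let mc : ℂ → PowerSeries ℂ := fun c =>
    PowerSeries.map (Polynomial.eval₂RingHom Complex.ofRealHom c) P
  let fc : ℂ → ℕ → ℂ := fun c => Function.update (fun k => (f k : ℂ)) 2 c
  let hc : ℕ → ℕ → ℂ := fun k l => (h k l : ℂ)
  have hmc : ∀ c, IsRecursiveSolution (a : ℂ) (fc c) hc μ (mc c) := fun c =>
    hP.map_eval₂ Complex.ofRealHom c
  let e : ℕ → ℂ → ℂ := fun i c =>
    (-1) ^ i * PowerSeries.coeff (i + 2) (ringFormalComp hc (mc c)) / (gammaWeight a i : ℂ)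
  have hf' : ∀ i, ‖(f (i + 2) : ℂ)‖ / gammaWeight a i ≤ B * (ρ ^ (i + 2))⁻¹ / gammaWeight a i :=
    fun i => by
      rw [Complex.norm_real]
      exact div_le_div_of_nonneg_right (hfb _) (gammaWeight_pos ha i).le
  have hebound : ∀ c ∈ Metric.ball (0 : ℂ) R, ∀ i, ‖e i c‖ ≤ compMajorant a K i := by
    intro c hc'
    obtain ⟨n, hn⟩ := eq_X_sq_mul (hmc c).1 (hmc c).2.1
    have hcomp : ∀ N, WeightBounded a N (F + 1) n → ∀ i ≤ N, ‖e i c‖ ≤ compMajorant a K i := by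
      intro N hN i hi
      simp only [e, hn]
      rw [compMajorant]
      -- Index `i` belongs to degree `i + 2`, so `i < 3` means degree below 5, where the composition
      -- vanishes.
      split_ifs with hlt
      · rw [coeff_ringFormalComp_of_lt_five (fun l => by simp [hc, h0])
          (fun l => by simp [hc, h1]) (fun l => by simp [hc, h2]) n (by omega)]
        simp
      · obtain ⟨k, rfl⟩ := Nat.exists_eq_add_of_le (not_lt.mp hlt)
        have := hKb hc (fun l => by simp [hc, h0]) (fun l => by simp [hc, h1])
          (fun l => by simp [hc, h2]) (fun k l => by simpa [hc] using hhb k l) N n hN k (by omega)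
        have hv := gammaWeight_pos ha (3 + k)
        rw [norm_div, norm_mul, norm_pow, norm_neg, norm_one, one_pow, one_mul,
          Complex.norm_of_nonneg hv.le, Nat.add_sub_cancel_left, ← mul_div_assoc,
          show 3 + k + 2 = k + 5 by ring]
        exact div_le_div_of_nonneg_right this hv.le
    have hfsum : ∀ j, ∑ i ∈ Finset.range (j + 1), ‖fc c (i + 2)‖ / gammaWeight a i ≤ F := by
      intro j
      rw [Finset.sum_range_succ', add_comm]
      refine add_le_add ?_ ?_
      · have : ‖c‖ ≤ R := (mem_ball_zero_iff.mp hc').le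
        simpa [fc] using div_le_div_of_nonneg_right this hv0.le
      · rw [hfs.tsum_eq_zero_add]
        refine le_add_of_nonneg_of_le (hfn 0) ?_
        refine (Finset.sum_le_sum fun i _ => ?_).trans
          (((summable_nat_add_iff 1).mpr hfs).sum_le_tsum (Finset.range j) fun i _ => hfn _)
        have : fc c (i + 1 + 2) = f (i + 1 + 2) := by simp [fc]
        rw [this]
        exact hf' (i + 1)
    have hsol := hmc c
    rw [hn] at hsol
    have hb := hsol.weightBounded ha hμ0 hK.le hfsum (by linarith : F + μ * T ≤ F + 1)
      (by simpa only [e, hn] using hcomp)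
    exact fun i => hcomp i (hb i) i le_rfl
  have hediff : ∀ i, Differentiable ℂ (e i) := fun i =>
    ((differentiable_coeff_ringFormalComp_map P h (i + 2)).const_mul _).div_const _
  have hmaj := summable_compMajorant ha K
  have hA : Summable fun i : ℕ => (-1) ^ i * (f (i + 2) : ℂ) / (gammaWeight a i : ℂ) := by
    refine Summable.of_norm_bounded hfs fun i => ?_
    rw [norm_div, norm_mul, norm_pow, norm_neg, norm_one, one_pow, one_mul,
      Complex.norm_of_nonneg (gammaWeight_pos ha i).le]
    exact hf' i
  -- The constant omits the `f 2` term of the series, whose place is taken by `c / gammaWeight a 0`.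
  refine ⟨(∑' i : ℕ, (-1) ^ i * (f (i + 2) : ℂ) / (gammaWeight a i : ℂ))
    - f 2 / gammaWeight a 0, fun c => ∑' i, e i c, ?_, ?_, ?_⟩
  · exact Complex.differentiableOn_tsum_of_summable_norm hmaj
      (fun i => (hediff i).differentiableOn) Metric.isOpen_ball (fun i c hc' => hebound c hc' i)
  · exact fun c hc' => tsum_of_norm_bounded hmaj.hasSum (hebound c hc')
  · intro c hcR
    have hcball : (c : ℂ) ∈ Metric.ball (0 : ℂ) R := by simpa using hcR
    have hup0 : Function.update f 2 c 0 = 0 := by simpa using f0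
    have hup1 : Function.update f 2 c 1 = 0 := by simpa using f1
    have hiff := isFormalCenterManifold_iff (a := a) (μ := μ) hup0 hup1 h0 h1
    have hex := existsUnique_isRecursiveSolution a (Function.update f 2 c) h0 μ
    refine ⟨by simpa only [hiff] using hex, fun m hm => ?_⟩
    rw [hiff] at hm
    -- By uniqueness, the complexified real solution is the parametric solution specialised at `c`.
    have hmC : PowerSeries.map Complex.ofRealHom m = mc c := by
      refine (existsUnique_isRecursiveSolution (a : ℂ) (fc c) (h := hc) (fun l => by simp [hc, h0])
        μ).unique ?_ (hmc c)
      have hfc : fc c = fun k => Complex.ofRealHom (Function.update f 2 c k) := by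
        funext k
        by_cases hk : k = 2
        · subst hk; simp [fc]
        · simp [fc, hk]
      rw [hfc]
      exact hm.map Complex.ofRealHom
    have hes : Summable fun i => e i c := Summable.of_norm_bounded hmaj (hebound c hcball)
    have hfirst : HasSum (fun i : ℕ => (-1) ^ i * fc c (i + 2) / (gammaWeight a i : ℂ))
        ((∑' i : ℕ, (-1) ^ i * (f (i + 2) : ℂ) / (gammaWeight a i : ℂ))
          - f 2 / gammaWeight a 0 + c / gammaWeight a 0) := by
      have hfc : (fun i : ℕ => (-1) ^ i * fc c (i + 2) / (gammaWeight a i : ℂ))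
          = Function.update (fun i : ℕ => (-1) ^ i * (f (i + 2) : ℂ) / (gammaWeight a i : ℂ)) 0
            ((c : ℂ) / gammaWeight a 0) := by
        funext i
        by_cases hi : i = 0
        · subst hi; simp [fc]
        · simp [fc, hi]
      have hval : (∑' i : ℕ, (-1) ^ i * (f (i + 2) : ℂ) / (gammaWeight a i : ℂ))
            - f 2 / gammaWeight a 0 + c / gammaWeight a 0
          = c / gammaWeight a 0 - (-1) ^ 0 * (f (0 + 2) : ℂ) / (gammaWeight a 0 : ℂ)
            + ∑' i : ℕ, (-1) ^ i * (f (i + 2) : ℂ) / (gammaWeight a i : ℂ) := by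
        rw [pow_zero, one_mul, zero_add]
        ring
      rw [hfc, hval]
      exact hA.hasSum.update 0 ((c : ℂ) / gammaWeight a 0)
    have htot := (hfirst.add (hes.hasSum.mul_left (μ : ℂ))).tendsto_sum_nat
    have hre := (Complex.continuous_re.tendsto _).comp ((tendsto_add_atTop_iff_nat 1).mpr htot)
    rw [← tendsto_add_atTop_iff_nat 2]
    refine hre.congr fun j => ?_
    have hcoef := (hmc c).coeff_div_gammaWeight ha j
    simp only [Function.comp_apply]
    change Complex.re (∑ i ∈ Finset.range (j + 1), ((-1) ^ i * fc c (i + 2) / (gammaWeight a i : ℂ)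
      + μ * ((-1) ^ i * PowerSeries.coeff (i + 2) (ringFormalComp hc (mc c))
        / (gammaWeight a i : ℂ)))) = _
    rw [← hcoef, ← hmC, PowerSeries.coeff_map, gammaWeight]
    have : ((-1 : ℂ) ^ j * Complex.ofRealHom (PowerSeries.coeff (j + 2) m)
        / ((Real.Gamma (j + 2 + a) : ℝ) : ℂ))
        = (((-1) ^ j * PowerSeries.coeff (j + 2) m / Real.Gamma (j + 2 + a) : ℝ) : ℂ) := by
      push_cast; rfl
    rw [this, Complex.ofReal_re]
    push_cast
    ring

end SInfty

/-! ### Asymptotic expansions at the origin. -/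

section TaylorExpansion

open Asymptotics

/-- The function `f` has the formal power series `p` as asymptotic expansion at `0`. -/
def HasTaylorExpansion (f : ℝ → ℝ) (p : PowerSeries ℝ) : Prop :=
  ∀ n : ℕ, (fun x => f x - (PowerSeries.trunc n p).eval x) =O[𝓝 0] fun x => x ^ n

theorem isBigO_eval_of_X_pow_dvd {n : ℕ} {P : Polynomial ℝ} (hP : Polynomial.X ^ n ∣ P) :
    (fun x => P.eval x) =O[𝓝 0] fun x : ℝ => x ^ n := by
  obtain ⟨Q, rfl⟩ := hP
  have : (fun x => Q.eval x) =O[𝓝 0] fun _ : ℝ => (1 : ℝ) :=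
    (Q.continuous.tendsto 0).isBigO_one ℝ
  simpa using (isBigO_refl (fun x : ℝ => x ^ n) (𝓝 0)).mul this

variable {f g : ℝ → ℝ} {p q : PowerSeries ℝ}

theorem HasTaylorExpansion.congr (hf : HasTaylorExpansion f p) (hfg : f =ᶠ[𝓝 0] g) :
    HasTaylorExpansion g p := fun n =>
  (hf n).congr' (hfg.mono fun x hx => by simp only [hx]) EventuallyEq.rfl

theorem hasTaylorExpansion_eval (P : Polynomial ℝ) :
    HasTaylorExpansion (fun x => P.eval x) (P : PowerSeries ℝ) := by
  intro n
  have : Polynomial.X ^ n ∣ P - PowerSeries.trunc n (P : PowerSeries ℝ) := by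
    rw [Polynomial.X_pow_dvd_iff]
    intro d hd
    rw [Polynomial.coeff_sub, PowerSeries.coeff_trunc, if_pos hd, Polynomial.coeff_coe, sub_self]
  simpa using isBigO_eval_of_X_pow_dvd this

theorem HasTaylorExpansion.add (hf : HasTaylorExpansion f p) (hg : HasTaylorExpansion g q) :
    HasTaylorExpansion (fun x => f x + g x) (p + q) := by
  intro n
  refine ((hf n).add (hg n)).congr_left fun x => ?_
  rw [map_add, Polynomial.eval_add]
  ring

theorem HasTaylorExpansion.mul (hf : HasTaylorExpansion f p) (hg : HasTaylorExpansion g q) :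
    HasTaylorExpansion (fun x => f x * g x) (p * q) := by
  intro n
  have hgO : g =O[𝓝 0] fun _ : ℝ => (1 : ℝ) := by
    simpa using hg 0
  have hpO : (fun x => (PowerSeries.trunc n p).eval x) =O[𝓝 0] fun _ : ℝ => (1 : ℝ) :=
    ((PowerSeries.trunc n p).continuous.tendsto 0).isBigO_one ℝ
  have hd : Polynomial.X ^ n ∣
      PowerSeries.trunc n p * PowerSeries.trunc n q - PowerSeries.trunc n (p * q) := by
    rw [Polynomial.X_pow_dvd_iff]
    intro d hd
    rw [Polynomial.coeff_sub, PowerSeries.coeff_trunc, if_pos hd, sub_eq_zero,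
      ← Polynomial.coeff_coe, Polynomial.coe_mul, PowerSeries.coeff_mul_eq_coeff_trunc_mul_trunc p q hd]
  have h1 := (hf n).mul hgO
  have h2 := hpO.mul (hg n)
  simp only [mul_one, one_mul] at h1 h2
  refine ((h1.add h2).add (isBigO_eval_of_X_pow_dvd hd)).congr_left fun x => ?_
  rw [Polynomial.eval_sub, Polynomial.eval_mul]
  ring

theorem hasTaylorExpansion_const (c : ℝ) : HasTaylorExpansion (fun _ => c) (PowerSeries.C c) := by
  simpa using hasTaylorExpansion_eval (Polynomial.C c)

theorem hasTaylorExpansion_id : HasTaylorExpansion (fun x => x) PowerSeries.X := by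
  simpa using hasTaylorExpansion_eval Polynomial.X

theorem HasTaylorExpansion.pow (hf : HasTaylorExpansion f p) (l : ℕ) :
    HasTaylorExpansion (fun x => f x ^ l) (p ^ l) := by
  induction l with
  | zero => simpa using hasTaylorExpansion_const 1
  | succ l ih => simpa only [pow_succ] using ih.mul hf

theorem HasTaylorExpansion.sum {ι : Type*} (s : Finset ι) {F : ι → ℝ → ℝ} {P : ι → PowerSeries ℝ}
    (h : ∀ i ∈ s, HasTaylorExpansion (F i) (P i)) :
    HasTaylorExpansion (fun x => ∑ i ∈ s, F i x) (∑ i ∈ s, P i) := by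
  classical
  induction s using Finset.induction_on with
  | empty => simpa using hasTaylorExpansion_const 0
  | insert i s hi ih =>
    simp only [Finset.sum_insert hi]
    exact (h i (Finset.mem_insert_self i s)).add (ih fun j hj => h j (Finset.mem_insert_of_mem hj))

theorem HasTaylorExpansion.unique (hp : HasTaylorExpansion f p) (hq : HasTaylorExpansion f q) :
    p = q := by
  ext n
  induction n using Nat.strong_induction_on with
  | _ n ih =>
  have h1 := (hq (n + 1)).sub (hp (n + 1))
  have h2 : (fun x : ℝ => (PowerSeries.coeff n p - PowerSeries.coeff n q) * x ^ n)
      =O[𝓝 0] fun x => x ^ (n + 1) := by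
    refine h1.congr_left fun x => ?_
    have ht : PowerSeries.trunc n p = PowerSeries.trunc n q := by
      ext d
      simp only [PowerSeries.coeff_trunc]
      split_ifs with hd
      · exact ih d hd
      · rfl
    rw [PowerSeries.trunc_succ, PowerSeries.trunc_succ, ht]
    simp only [Polynomial.eval_add, Polynomial.eval_monomial]
    ring
  have h3 : (fun _ : ℝ => PowerSeries.coeff n p - PowerSeries.coeff n q)
      =O[𝓝[≠] 0] fun x : ℝ => x := by
    have h4 := (h2.mono (nhdsWithin_le_nhds (s := {0}ᶜ))).mul
      (isBigO_refl (fun x : ℝ => (x ^ n)⁻¹) _)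
    refine h4.congr' ?_ ?_
    · filter_upwards [self_mem_nhdsWithin] with x hx
      exact mul_inv_cancel_right₀ (pow_ne_zero n hx) _
    · filter_upwards [self_mem_nhdsWithin] with x hx
      rw [pow_succ', mul_inv_cancel_right₀ (pow_ne_zero n hx)]
  have h5 : Tendsto (fun _ : ℝ => PowerSeries.coeff n p - PowerSeries.coeff n q) (𝓝[≠] 0) (𝓝 0) :=
    h3.trans_tendsto (tendsto_id.mono_left nhdsWithin_le_nhds)
  exact sub_eq_zero.mp (tendsto_nhds_unique tendsto_const_nhds h5)

theorem AnalyticAt.hasTaylorExpansion (hf : AnalyticAt ℝ f 0) :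
    HasTaylorExpansion f (PowerSeries.mk fun n => iteratedDeriv n f 0 / n.factorial) := by
  intro n
  have h := hf.hasFPowerSeriesAt.isBigO_sub_partialSum_pow n
  have e : (fun x : ℝ => ‖x‖ ^ n) = fun x => ‖x ^ n‖ := by
    funext x; rw [norm_pow]
  rw [e, isBigO_norm_right] at h
  refine h.congr_left fun x => ?_
  rw [zero_add, ← Polynomial.eval₂_id, PowerSeries.eval₂_trunc_eq_sum_range,
    FormalMultilinearSeries.partialSum]
  simp [mul_comm]

/-- Once `R * |x| ≤ 1`, every term outside `s` is at most `|b i| * (R * |x|) ^ n`, and these bounds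
are summable. -/
theorem isBigO_tsum_sub_sum {ι : Type*} {t : ι → ℝ → ℝ} {b : ι → ℝ} {d : ι → ℕ} {R : ℝ}
    (hR : 0 < R) (hb : Summable b)
    (ht : ∀ᶠ x in 𝓝 (0 : ℝ), ∀ i, |t i x| ≤ b i * (R * |x|) ^ d i) {n : ℕ} (s : Finset ι)
    (hs : ∀ i ∉ s, n ≤ d i) :
    (fun x => ∑' i, t i x - ∑ i ∈ s, t i x) =O[𝓝 0] fun x => x ^ n := by
  classical
  have hsmall : ∀ᶠ x in 𝓝 (0 : ℝ), R * |x| ≤ 1 := by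
    have : Tendsto (fun x : ℝ => R * |x|) (𝓝 0) (𝓝 (R * |0|)) :=
      (continuous_const.mul continuous_abs).tendsto 0
    rw [abs_zero, mul_zero] at this
    exact this.eventually (ge_mem_nhds one_pos)
  refine IsBigO.of_bound ((∑' i, |b i|) * R ^ n) ?_
  filter_upwards [ht, hsmall] with x hx hx1
  have hx0 : 0 ≤ R * |x| := by positivity
  have hsum : Summable fun i => t i x := by
    refine Summable.of_norm_bounded hb.abs fun i => (hx i).trans ?_
    calc b i * (R * |x|) ^ d i ≤ |b i| * 1 :=
          mul_le_mul (le_abs_self _) (pow_le_one₀ hx0 hx1) (pow_nonneg hx0 _) (abs_nonneg _)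
      _ = |b i| := mul_one _
  have hdiff := hsum.hasSum.sub (hasSum_sum_of_ne_finset_zero (f := fun i => if i ∈ s then t i x else 0)
    (s := s) fun i hi => if_neg hi)
  rw [Finset.sum_congr rfl fun i hi => if_pos hi] at hdiff
  rw [← hdiff.tsum_eq]
  have hbd : ∀ i, ‖t i x - if i ∈ s then t i x else 0‖ ≤ |b i| * (R * |x|) ^ n := by
    intro i
    split_ifs with hi
    · rw [sub_self, norm_zero]; positivity
    · rw [sub_zero]
      exact (hx i).trans (mul_le_mul (le_abs_self _)
        (pow_le_pow_of_le_one hx0 hx1 (hs i hi)) (pow_nonneg hx0 _) (abs_nonneg _))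
  refine (tsum_of_norm_bounded (hb.abs.hasSum.mul_right _) hbd).trans_eq ?_
  rw [norm_pow, Real.norm_eq_abs, mul_pow, mul_assoc]

end TaylorExpansion

/-! ### Analytic center manifolds and the vanishing of the limit. -/

section CenterManifoldExpansion

open Asymptotics

variable {B ρ : ℝ} {f : ℕ → ℝ} {h : ℕ → ℕ → ℝ}

/-- The scale `2 / ρ` instead of `1 / ρ` frees a factor `(1 / 2) ^ d`, which serves as the summable
majorant. -/
theorem inv_pow_mul_pow_eq (hρ : 0 < ρ) (x : ℝ) (d : ℕ) :
    (ρ ^ d)⁻¹ * |x| ^ d = (1 / 2) ^ d * (2 / ρ * |x|) ^ d := by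
  rw [← inv_pow, ← mul_pow, ← mul_pow]
  congr 1
  field_simp

theorem hasTaylorExpansion_tsum (hρ : 0 < ρ) (hf : ∀ k, |f k| ≤ B * (ρ ^ k)⁻¹) :
    HasTaylorExpansion (fun x => ∑' k, f k * x ^ k) (PowerSeries.mk f) := by
  intro n
  have := isBigO_tsum_sub_sum (t := fun k x => f k * x ^ k) (b := fun k => B * (1 / 2) ^ k)
    (d := fun k => k) (R := 2 / ρ) (by positivity) (summable_geometric_two.mul_left B)
    (Eventually.of_forall fun x k => by
      rw [abs_mul, abs_pow, mul_assoc, ← inv_pow_mul_pow_eq hρ, ← mul_assoc]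
      exact mul_le_mul_of_nonneg_right (hf k) (by positivity)) (n := n) (Finset.range n)
    (fun i hi => not_lt.mp fun hlt => hi (Finset.mem_range.mpr hlt))
  refine this.congr_left fun x => ?_
  rw [← Polynomial.eval₂_id, PowerSeries.eval₂_trunc_eq_sum_range]
  simp

/-- The square truncation here and the triangular one in `formalComp` differ in degree `j` only by
terms that vanish: those with `X`-exponent above `j`, or with `l > j`, where `X ^ l` divides `p ^
l`. -/
theorem coeff_sum_range_eq_coeff_formalComp {p : PowerSeries ℝ} (hp : PowerSeries.coeff 0 p = 0)
    {n j : ℕ} (hj : j < n) :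
    PowerSeries.coeff j (∑ q ∈ Finset.range n ×ˢ Finset.range n,
      PowerSeries.C (h q.1 q.2) * PowerSeries.X ^ q.1 * p ^ q.2)
      = PowerSeries.coeff j (formalComp h p) := by
  have hcoef : ∀ i l, PowerSeries.coeff j (PowerSeries.C (h i l) * PowerSeries.X ^ i * p ^ l)
      = if i ≤ j then h i l * PowerSeries.coeff (j - i) (p ^ l) else 0 := by
    intro i l
    rw [mul_assoc, PowerSeries.coeff_C_mul, PowerSeries.coeff_X_pow_mul']
    split_ifs <;> simp
  have hpX : PowerSeries.X ∣ p := PowerSeries.X_dvd_iff.mpr (by simpa using hp)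
  have hzero : ∀ i l, j < l → PowerSeries.coeff i (p ^ l) = 0 ∨ j < i := by
    intro i l hl
    by_cases hi : j < i
    · exact Or.inr hi
    · exact Or.inl (PowerSeries.X_pow_dvd_iff.mp (pow_dvd_pow_of_dvd hpX l) i (by omega))
  rw [map_sum, Finset.sum_product_right, formalComp, PowerSeries.coeff_mk]
  have hinner : ∀ l, ∑ i ∈ Finset.range n, PowerSeries.coeff j
      (PowerSeries.C (h i l) * PowerSeries.X ^ i * p ^ l)
      = ∑ q ∈ Finset.HasAntidiagonal.antidiagonal j, h q.1 l * PowerSeries.coeff q.2 (p ^ l) := by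
    intro l
    rw [Finset.Nat.sum_antidiagonal_eq_sum_range_succ_mk]
    refine (Finset.sum_subset_zero_on_sdiff (Finset.range_subset_range.mpr hj) ?_ ?_).symm
    · intro i hi
      rw [hcoef, if_neg]
      simp at hi
      omega
    · intro i hi
      rw [hcoef, if_pos (Nat.lt_succ_iff.mp (Finset.mem_range.mp hi))]
  simp_rw [hinner]
  refine (Finset.sum_subset_zero_on_sdiff (Finset.range_subset_range.mpr hj) ?_
    fun _ _ => rfl).symm
  intro l hl
  refine Finset.sum_eq_zero fun q hq => ?_
  have hq' := Finset.HasAntidiagonal.mem_antidiagonal.mp hq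
  have hlj : j < l := by simp at hl; omega
  rcases hzero q.2 l hlj with h0 | h0
  · rw [h0, mul_zero]
  · omega

theorem HasTaylorExpansion.tsum_comp (hρ : 0 < ρ) (hh : ∀ k l, |h k l| ≤ (ρ ^ (k + l))⁻¹)
    {m : ℝ → ℝ} {p : PowerSeries ℝ} (hm : HasTaylorExpansion m p)
    (hp : PowerSeries.coeff 0 p = 0) (hmx : ∀ᶠ x in 𝓝 (0 : ℝ), |m x| ≤ |x|) :
    HasTaylorExpansion (fun x => ∑' q : ℕ × ℕ, h q.1 q.2 * x ^ q.1 * m x ^ q.2)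
      (formalComp h p) := by
  intro n
  have h1 := isBigO_tsum_sub_sum (t := fun (q : ℕ × ℕ) x => h q.1 q.2 * x ^ q.1 * m x ^ q.2)
    (b := fun q => (1 / 2) ^ q.1 * (1 / 2) ^ q.2) (d := fun q => q.1 + q.2) (R := 2 / ρ)
    (by positivity)
    (summable_geometric_two.mul_of_nonneg summable_geometric_two (fun _ => by positivity)
      (fun _ => by positivity))
    (by
      filter_upwards [hmx] with x hx q
      rw [abs_mul, abs_mul, abs_pow, abs_pow, ← pow_add, ← inv_pow_mul_pow_eq hρ, pow_add |x|,
        ← mul_assoc]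
      gcongr
      exact hh _ _) (n := n) (Finset.range n ×ˢ Finset.range n)
    (fun q hq => by
      by_contra hlt
      exact hq (Finset.mem_product.mpr ⟨Finset.mem_range.mpr (by omega),
        Finset.mem_range.mpr (by omega)⟩))
  have h2 := HasTaylorExpansion.sum (Finset.range n ×ˢ Finset.range n)
    (fun q _ => ((hasTaylorExpansion_const (h q.1 q.2)).mul (hasTaylorExpansion_id.pow q.1)).mul
      (hm.pow q.2)) n
  have ht : PowerSeries.trunc n (∑ q ∈ Finset.range n ×ˢ Finset.range n,
      PowerSeries.C (h q.1 q.2) * PowerSeries.X ^ q.1 * p ^ q.2)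
      = PowerSeries.trunc n (formalComp h p) := by
    ext j
    simp only [PowerSeries.coeff_trunc]
    split_ifs with hj
    · exact coeff_sum_range_eq_coeff_formalComp hp hj
    · rfl
  rw [ht] at h2
  refine (h1.add h2).congr_left fun x => ?_
  ring

theorem derivative_mk_iteratedDeriv (m : ℝ → ℝ) :
    PowerSeries.derivative ℝ (PowerSeries.mk fun n => iteratedDeriv n m 0 / n.factorial)
      = PowerSeries.mk fun n => iteratedDeriv n (deriv m) 0 / n.factorial := by
  ext n
  rw [PowerSeries.coeff_derivative, PowerSeries.coeff_mk, PowerSeries.coeff_mk, iteratedDeriv_succ',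
    Nat.factorial_succ]
  push_cast
  have : (n : ℝ) + 1 ≠ 0 := by positivity
  field_simp

/-- The Taylor series of an analytic center manifold is the formal center manifold. -/
theorem IsCenterManifold.isFormalCenterManifold (hρ : 0 < ρ) (hf : AdmissibleF B ρ f)
    (hh : AdmissibleH ρ h) {a μ : ℝ} {m : ℝ → ℝ} (hm : IsCenterManifold a (nonlinearity f h μ) m)
    (hma : AnalyticAt ℝ m 0) :
    IsFormalCenterManifold a f h μ
      (PowerSeries.mk fun n => iteratedDeriv n m 0 / n.factorial) := by
  obtain ⟨-, m0, m1, heq⟩ := hm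
  have c0 : PowerSeries.coeff 0 (PowerSeries.mk fun n => iteratedDeriv n m 0 / n.factorial) = 0 := by
    simp [m0]
  have hT := AnalyticAt.hasTaylorExpansion hma
  have hT' := AnalyticAt.hasTaylorExpansion hma.deriv
  rw [← derivative_mk_iteratedDeriv] at hT'
  refine ⟨c0, by simp [m1], ?_⟩
  have hmx : ∀ᶠ x in 𝓝 (0 : ℝ), |m x| ≤ |x| := by
    have hd := hma.differentiableAt.hasDerivAt
    rw [m1, hasDerivAt_iff_isLittleO] at hd
    filter_upwards [hd.bound one_pos] with x hx
    simpa [m0] using hx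
  have hl := ((hasTaylorExpansion_id.pow 2).mul hT').add (hT.mul
    ((hasTaylorExpansion_const 1).add ((hasTaylorExpansion_const a).mul hasTaylorExpansion_id)))
  have hr := (hasTaylorExpansion_tsum hρ hf.2.2).add
    ((hasTaylorExpansion_const μ).mul (hT.tsum_comp hρ hh.2.2.2 c0 hmx))
  rw [map_one] at hl
  refine hl.unique (hr.congr ?_)
  filter_upwards [heq] with x hx
  rw [hx, nonlinearity]
  ring

theorem exists_abs_iteratedDeriv_div_factorial_le {m : ℝ → ℝ} (hma : AnalyticAt ℝ m 0) :
    ∃ C r : ℝ, 0 < r ∧ ∀ n : ℕ, |iteratedDeriv n m 0 / n.factorial| ≤ C * r ^ n := by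
  obtain ⟨r, hr⟩ := hma.hasFPowerSeriesAt
  obtain ⟨C, r', -, hr', hC⟩ := FormalMultilinearSeries.le_mul_pow_of_radius_pos _
    (hr.r_pos.trans_le hr.r_le)
  refine ⟨C, r', hr', fun n => ?_⟩
  have := hC n
  rwa [FormalMultilinearSeries.ofScalars_norm] at this

/-- Taylor coefficients of an analytic function grow at most geometrically, so after division by the
Gamma weights they tend to 0. -/
theorem eq_zero_of_hasAnalyticCenterManifold {a : ℝ} (ha : -2 < a) (hρ : 0 < ρ)
    (hf : AdmissibleF B ρ f) (hh : AdmissibleH ρ h) {μ s : ℝ} (hs : HasSInfty a f h μ s)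
    (hm : HasAnalyticCenterManifold a (nonlinearity f h μ)) : s = 0 := by
  obtain ⟨m, hm, hma⟩ := hm
  have hlim := hs.2 _ (hm.isFormalCenterManifold hρ hf hh hma)
  obtain ⟨C, r, hr, hC⟩ := exists_abs_iteratedDeriv_div_factorial_le hma
  refine tendsto_nhds_unique ((tendsto_add_atTop_iff_nat 2).mpr hlim) ?_
  have hmaj := (summable_pow_div_gammaWeight ha r hr).tendsto_atTop_zero.const_mul (C * r ^ 2)
  rw [mul_zero] at hmaj
  refine squeeze_zero_norm (fun k => ?_) hmaj
  have hv := gammaWeight_pos ha k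
  have e : Real.Gamma ((k + 2 : ℕ) + a) = gammaWeight a k := by rw [gammaWeight]; push_cast; rfl
  rw [e, PowerSeries.coeff_mk, norm_div, norm_mul, norm_pow, norm_neg, norm_one, one_pow, one_mul,
    Real.norm_of_nonneg hv.le, ← mul_div_assoc, mul_assoc, ← pow_add, add_comm 2 k]
  exact div_le_div_of_nonneg_right (hC (k + 2)) hv.le

theorem AdmissibleF.summable_eventually (hρ : 0 < ρ) (hf : AdmissibleF B ρ f) :
    ∀ᶠ x in 𝓝 (0 : ℝ), Summable fun k => f k * x ^ k := by
  have : ∀ᶠ x in 𝓝 (0 : ℝ), |x| < ρ := by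
    have := continuous_abs.tendsto (0 : ℝ)
    rw [abs_zero] at this
    exact this.eventually (gt_mem_nhds hρ)
  filter_upwards [this] with x hx
  refine Summable.of_norm_bounded ((summable_geometric_of_lt_one (r := |x| / ρ) (by positivity)
    ((div_lt_one hρ).mpr hx)).mul_left B) fun k => ?_
  rw [Real.norm_eq_abs, abs_mul, abs_pow, div_pow, div_eq_inv_mul, ← mul_assoc]
  exact mul_le_mul_of_nonneg_right (hf.2.2 k) (by positivity)

/-- The larger constant `B'` is needed for parameters in a neighbourhood of the interval, which may
violate the original bound. -/
theorem AdmissibleF.update {B' c : ℝ} (hρ : 0 < ρ) (hf : AdmissibleF B ρ f) (hB : B ≤ B')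
    (hc : |c| ≤ B' * (ρ ^ 2)⁻¹) : AdmissibleF B' ρ (Function.update f 2 c) := by
  refine ⟨by simpa using hf.1, by simpa using hf.2.1, fun k => ?_⟩
  by_cases hk : k = 2
  · subst hk; simpa using hc
  · rw [Function.update_of_ne hk]
    exact (hf.2.2 k).trans (mul_le_mul_of_nonneg_right hB (by positivity))

/-- Adding `q * x ^ 2` amounts to changing the coefficient `f 2`. -/
theorem HasAnalyticCenterManifold.update {a μ q : ℝ} (hρ : 0 < ρ) (hf : AdmissibleF B ρ f)
    (hm : HasAnalyticCenterManifold a (fun x y => nonlinearity f h μ x y + q * x ^ 2)) :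
    HasAnalyticCenterManifold a (nonlinearity (Function.update f 2 (f 2 + q)) h μ) := by
  obtain ⟨m, ⟨h1, h2, h3, h4⟩, hma⟩ := hm
  refine ⟨m, ⟨h1, h2, h3, ?_⟩, hma⟩
  filter_upwards [h4, hf.summable_eventually hρ] with x hx hs
  have hup := hs.hasSum.update 2 ((f 2 + q) * x ^ 2)
  have e : Function.update (fun k => f k * x ^ k) 2 ((f 2 + q) * x ^ 2)
      = fun k => Function.update f 2 (f 2 + q) k * x ^ k := by
    funext k
    by_cases hk : k = 2
    · subst hk; simp
    · simp [hk]
  rw [e] at hup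
  rw [hx, nonlinearity, nonlinearity, hup.tsum_eq]
  ring

end CenterManifoldExpansion

/-! ### Monotonicity in the parameter and the main theorem. -/

/-- Cauchy's estimate on the disc of radius `1 / 2` about `c` gives `‖deriv E c‖ ≤ 2 * T`, so the
linear term `1 / v` dominates. -/
theorem hasDerivAt_re_pos {E : ℂ → ℂ} {R T v μ c : ℝ} (hμ0 : 0 ≤ μ)
    (hμ : μ * (2 * T) < 1 / v) (s₀ : ℂ) (hE : DifferentiableOn ℂ E (Metric.ball 0 R))
    (hT : ∀ z ∈ Metric.ball (0 : ℂ) R, ‖E z‖ ≤ T) (hc : |c| + 1 ≤ R) :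
    ∃ S', 0 < S' ∧ HasDerivAt (fun x : ℝ => (s₀ + x / v + μ * E x).re) S' c := by
  have hsub : Metric.closedBall (c : ℂ) (1 / 2) ⊆ Metric.ball 0 R := by
    refine Metric.closedBall_subset_ball' ?_
    rw [dist_zero_right, Complex.norm_real, Real.norm_eq_abs]
    linarith
  have hd : DiffContOnCl ℂ E (Metric.ball (c : ℂ) (1 / 2)) :=
    (hE.mono (by rwa [closure_ball _ (by norm_num)])).diffContOnCl
  have hnorm := Complex.norm_deriv_le_of_forall_mem_sphere_norm_le (by norm_num) hd
    fun z hz => hT z (hsub (Metric.sphere_subset_closedBall hz))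
  have hcE : DifferentiableAt ℂ E c := hE.differentiableAt
    (Metric.isOpen_ball.mem_nhds (hsub (Metric.mem_closedBall_self (by norm_num))))
  have hder : HasDerivAt (fun z : ℂ => s₀ + z / v + μ * E z) (1 / v + μ * deriv E c) c :=
    (((hasDerivAt_id (c : ℂ)).div_const _).const_add s₀).add (hcE.hasDerivAt.const_mul _)
  refine ⟨_, ?_, hder.real_of_complex⟩
  have e : ((1 : ℂ) / v + μ * deriv E c).re = 1 / v + μ * (deriv E c).re := by
    rw [Complex.add_re, Complex.re_ofReal_mul, ← Complex.ofReal_one, ← Complex.ofReal_div,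
      Complex.ofReal_re]
  rw [e]
  have hre := (abs_le.mp ((Complex.abs_re_le_norm (deriv E c)).trans hnorm)).1
  have := mul_le_mul_of_nonneg_left hre hμ0
  have e2 : μ * -(T / (1 / 2)) = -(μ * (2 * T)) := by ring
  rw [e2] at this
  linarith

theorem mainTheorem5 (a : ℝ) (ha : -2 < a) (B ρ : ℝ) (hB : 0 < B) (hρ : 0 < ρ)
    (α β : ℝ) (hI : ∀ c ∈ Set.Icc α β, |c| ≤ B * (ρ ^ 2)⁻¹) :
    ∃ μ₀ : ℝ, 0 < μ₀ ∧ ∀ (μ : ℝ) (f : ℕ → ℝ) (h : ℕ → ℕ → ℝ), 0 ≤ μ → μ < μ₀ →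
      AdmissibleF B ρ f → AdmissibleH ρ h → f 2 ∈ Set.Icc α β →
      (∃ (U : Set ℝ) (S : ℝ → ℝ), IsOpen U ∧ Set.Icc α β ⊆ U ∧
        (∀ c ∈ U, HasSInfty a (Function.update f 2 c) h μ (S c)) ∧
        ContDiffOn ℝ 1 S U ∧
        (∀ c ∈ Set.Icc α β, deriv S c ≠ 0) ∧
        (HasAnalyticCenterManifold a (nonlinearity f h μ) → S (f 2) = 0)) ∧
      (HasAnalyticCenterManifold a (nonlinearity f h μ) →
        ∃ q₀ : ℝ, 0 < q₀ ∧ ∀ q : ℝ, q ≠ 0 → |q| < q₀ →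
          ¬ HasAnalyticCenterManifold a (fun x y => nonlinearity f h μ x y + q * x ^ 2)) ∧
      {c ∈ Set.Icc α β |
        HasAnalyticCenterManifold a (nonlinearity (Function.update f 2 c) h μ)}.Subsingleton := by
  have hB2 : 0 < B * (ρ ^ 2)⁻¹ := by positivity
  -- The extra 1 leaves room for the Cauchy discs and for an open neighbourhood of the interval.
  set R := B * (ρ ^ 2)⁻¹ + 1 with hR
  obtain ⟨μ₁, T, hμ₁, hT, hmain⟩ := exists_sInfty_decomposition ha hB hρ (R := R) (by linarith)
  have hv := gammaWeight_pos ha 0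
  set v := gammaWeight a 0
  -- The second bound yields `μ * (2 * T) < 1 / v`; the added 1 keeps the denominator positive when
  -- `T = 0`.
  refine ⟨min μ₁ (1 / v / (2 * T + 1)), lt_min hμ₁ (by positivity),
    fun μ f h hμ0 hμ hf hh hf2 => ?_⟩
  obtain ⟨s₀, E, hE, hET, hS⟩ := hmain μ f h hμ0 (hμ.trans_le (min_le_left _ _)) hf hh
  have hμT : μ * (2 * T) < 1 / v := by
    have := (lt_div_iff₀ (by positivity)).mp (hμ.trans_le (min_le_right _ _))
    linarith
  set S : ℝ → ℝ := fun x => (s₀ + x / v + μ * E x).re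
  have hIU : Set.Icc α β ⊆ {c : ℝ | |c| < R} := fun c hc => by
    have := hI c hc
    simp only [Set.mem_ofPred_eq]
    linarith
  have hU : IsOpen {c : ℝ | |c| < R} := isOpen_lt continuous_abs continuous_const
  have hder : ∀ c ∈ Set.Icc α β, ∃ S', 0 < S' ∧ HasDerivAt S S' c := fun c hc =>
    hasDerivAt_re_pos hμ0 hμT s₀ hE hET (by linarith [hI c hc])
  have hzero : ∀ c, |c| < R → HasAnalyticCenterManifold a (nonlinearity (Function.update f 2 c) h μ) →
      S c = 0 := fun c hc hm => by
    -- The modified coefficients are admissible with `R * ρ ^ 2` in place of `B`, since `|c| < R`.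
    have hBR : B ≤ R * ρ ^ 2 := by
      rw [hR, add_mul, inv_mul_cancel_right₀ (by positivity)]
      linarith [sq_nonneg ρ]
    refine eq_zero_of_hasAnalyticCenterManifold ha hρ (hf.update hρ hBR ?_) hh (hS c hc) hm
    rw [mul_inv_cancel_right₀ (by positivity)]
    exact hc.le
  have hzero2 : HasAnalyticCenterManifold a (nonlinearity f h μ) → S (f 2) = 0 := fun hm =>
    hzero _ (hIU hf2) (by rwa [Function.update_eq_self])
  refine ⟨⟨{c | |c| < R}, S, hU, hIU, hS, fun c hc => ?_, fun c hc => ?_, hzero2⟩, fun hm => ?_, ?_⟩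
  · have hcb : (c : ℂ) ∈ Metric.ball (0 : ℂ) R := by simpa using hc
    have hEc : ContDiffAt ℂ 1 E c :=
      (hE.analyticAt (Metric.isOpen_ball.mem_nhds hcb)).contDiffAt
    have : ContDiffAt ℂ 1 (fun z : ℂ => s₀ + z / v + μ * E z) c :=
      (contDiffAt_const.add (contDiffAt_id.div_const _)).add (contDiffAt_const.mul hEc)
    exact this.real_of_complex.contDiffWithinAt
  · obtain ⟨S', hS', hd⟩ := hder c hc
    rw [hd.deriv]
    exact hS'.ne'
  · obtain ⟨S', hS', hd⟩ := hder _ hf2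
    -- A nonzero derivative keeps `S` away from the value 0 on a punctured neighbourhood of `f 2`,
    -- while an analytic center manifold of the perturbed system would force `S (f 2 + q) = 0`.
    have hev := hd.eventually_ne (c := 0) hS'.ne'
    rw [eventually_nhdsWithin_iff] at hev
    obtain ⟨q₀, hq₀, hball⟩ := Metric.eventually_nhds_iff.mp
      (hev.and (hU.mem_nhds (hIU hf2)))
    refine ⟨q₀, hq₀, fun q hq hlt hmq => ?_⟩
    obtain ⟨hne, hmem⟩ := hball (y := f 2 + q) (by simpa [Real.dist_eq] using hlt)
    exact hne (by simpa using hq) (hzero _ hmem (hmq.update hρ hf))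
  · have hmono : StrictMonoOn S (Set.Icc α β) := by
      refine strictMonoOn_of_deriv_pos (convex_Icc α β) (fun c hc => ?_) fun c hc => ?_
      · obtain ⟨S', -, hd⟩ := hder c hc
        exact hd.continuousAt.continuousWithinAt
      · obtain ⟨S', hS', hd⟩ := hder c (interior_subset hc)
        rwa [hd.deriv]
    rintro c ⟨hc, hmc⟩ d ⟨hd, hmd⟩
    exact hmono.injOn hc hd ((hzero c (hIU hc) hmc).trans (hzero d (hIU hd) hmd).symm)
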